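/- Let $q$ be a prime power, let $m,n\geq 1$ be integers, and assume that $\gcd(q,n)=1$. For $d\mid n$, let $o_d(a)$ denote the multiplicative order of $a$ in $(\mathbb{Z}/d\mathbb{Z})^\times$, and set $t_{d,q}=\varphi(d)/o_d(q)$ and $n_{d,q}=o_d(q)/o_d(q^m)$, where $\varphi$ is Euler's totient function (these are positive integers). Put $s=\sum_{d\mid n}t_{d,q}$. A code of length $n$ over $\mathbb{F}_{q^m}$ is an $\mathbb{F}_{q^m}$-linear subspace of $\mathbb{F}_{q^m}^n$. For a vector $c=(c_1,\dots,c_n)\in\mathbb{F}_{q^m}^n$, its rank support is the $\mathbb{F}_q$-row space of the $m\times n$ matrix whose $j$-th column is the coordinate vector of $c_j$ in a fixed $\mathbb{F}_q$-basis of $\mathbb{F}_{q^m}$. The rank support of a subspace $D\subset\mathbb{F}_{q^m}^n$ is the subspace of $\mathbb{F}_q^n$ generated by the rank supports of its elements, and $\mathrm{wt}_R(D)$ is the dimension of the latter. The minimal rank distance of a non-zero code $\mathcal{C}$ is $M_1(\mathcal{C})=\min\{\mathrm{wt}_R(D) : D\subset\mathcal{C},\ \dim D=1\}$. We say that the minimal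 rank distance of $\mathcal{C}$ is different from $1$ if $\mathcal{C}=\{0\}$, or $\mathcal{C}\neq\{0\}$ and $M_1(\mathcal{C})\geq 2$. A code is cyclic if it is stable under $c\mapsto cM^t$, where $M$ is the companion matrix of $x^n-1$; identifying $(a_0,\dots,a_{n-1})$ with the class of $a_0+a_1x+\cdots+a_{n-1}x^{n-1}$, the cyclic codes are the ideals of $\mathbb{F}_{q^m}[x]/(x^n-1)$. Then the proportion $\mathbb{P}$, among all cyclic codes of length $n$ over $\mathbb{F}_{q^m}$, of those with minimal rank distance different from $1$ is $$\mathbb{P}=\prod_{d\mid n}\left(1-2^{-n_{d,q}}\right)^{t_{d,q}},$$ and $$\frac{1}{2^s}\leq\mathbb{P}\leq\prod_{d\mid n}\left(1-2^{-o_d(q)}\right)^{t_{d,q}}.$$ Moreover: 1. $\mathbb{P}=\dfrac{1}{2^s}$ if and only if any one of the following equivalent conditions is satisfied: (a) $\gcd(m,o_n(q))=1$; (b) every monic irreducible factor of $x^n-1$ in $\mathbb{F}_q[x]$ is irreducible in $\mathbb{F}_{q^m}[x]$; (c) every non-zero cyclic code $\mathcal{C}$ of length $n$ over $\mathbb{F}_{q^m}$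 has $M_1(\mathcal{C})=1$. 2. $\mathbb{P}=\prod_{d\mid n}\left(1-2^{-o_d(q)}\right)^{t_{d,q}}$ if and only if any one of the following equivalent conditions is satisfied: (a) $o_n(q)\mid m$; (b) $x^n-1$ splits completely in $\mathbb{F}_{q^m}[x]$. -/

import Mathlib

open Polynomial

namespace RankMetric

/-! ### Rank supports and generalized rank weights

`L / K` is a finite field extension and `B` a `K`-basis of `L`.  Codes of length `n` are
`L`-subspaces of `L ^ n`. -/

/-- The rank support of `c ∈ L ^ n`: the `K`-span of the rows of the matrix whose `j`-th column
consists of the coordinates of `c j` in the basis `B`. -/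
def rankSupport {K L ι : Type*} [Field K] [Field L] [Algebra K L] {n : ℕ}
    (B : Module.Basis ι K L) (c : Fin n → L) : Submodule K (Fin n → K) :=
  Submodule.span K (Set.range fun (i : ι) (j : Fin n) => B.repr (c j) i)

/-- The rank support of a subspace `D` of `L ^ n`: the `K`-subspace of `K ^ n` generated by the
rank supports of the elements of `D`. -/
def codeRankSupport {K L ι : Type*} [Field K] [Field L] [Algebra K L] {n : ℕ}
    (B : Module.Basis ι K L) (D : Submodule L (Fin n → L)) : Submodule K (Fin n → K) :=
  ⨆ c ∈ D, rankSupport B c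

/-- The rank weight `wt_R(D)` of a subspace `D` of `L ^ n`. -/
noncomputable def codeRankWeight {K L ι : Type*} [Field K] [Field L] [Algebra K L] {n : ℕ}
    (B : Module.Basis ι K L) (D : Submodule L (Fin n → L)) : ℕ :=
  Module.finrank K (codeRankSupport B D)

/-- The `r`-th generalized rank weight `M_r(C)`: the minimum of `wt_R(D)` over the subspaces `D`
of `C` of dimension `r` (meaningful for `1 ≤ r ≤ dim C`). -/
noncomputable def genRankWeight {K L ι : Type*} [Field K] [Field L] [Algebra K L] {n : ℕ}
    (B : Module.Basis ι K L) (r : ℕ) (C : Submodule L (Fin n → L)) : ℕ :=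
  sInf {w | ∃ D : Submodule L (Fin n → L), D ≤ C ∧ Module.finrank L D = r ∧
    codeRankWeight B D = w}

/-- The minimal rank distance of `C` is different from `1`: either `C` is zero (and then has no
minimal rank distance), or `C` is non-zero and `M_1(C) ≥ 2`. -/
def MinRankDistNeOne {K L ι : Type*} [Field K] [Field L] [Algebra K L] {n : ℕ}
    (B : Module.Basis ι K L) (C : Submodule L (Fin n → L)) : Prop :=
  C = ⊥ ∨ (C ≠ ⊥ ∧ 2 ≤ genRankWeight B 1 C)

/-! ### Codes stable under a matrix, cyclic codes -/

/-- A code `C ⊆ L ^ n` is an `M`-code, where `M` is a matrix over `K`, if it is stable under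
`c ↦ c Mᵗ`. -/
def IsMCode {K L : Type*} [Field K] [Field L] [Algebra K L] {n : ℕ}
    (M : Matrix (Fin n) (Fin n) K) (C : Submodule L (Fin n → L)) : Prop :=
  ∀ c ∈ C, Matrix.vecMul c (M.map (algebraMap K L)).transpose ∈ C

/-- The companion matrix of a monic polynomial `P` of degree `n`: ones on the subdiagonal, and
last column `-a_0, …, -a_{n-1}`. -/
def companionMatrix {K : Type*} [Field K] (n : ℕ) (P : K[X]) : Matrix (Fin n) (Fin n) K :=
  Matrix.of fun i j =>
    if (j : ℕ) + 1 = n then - P.coeff i else if (i : ℕ) = j + 1 then 1 else 0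

/-- A cyclic code of length `n` over `L`: an `M`-code for the companion matrix `M` of `x ^ n - 1`.
Under the identification of `L ^ n` with `L[x] / (x ^ n - 1)` given by
`(a_0, …, a_{n-1}) ↦ a_0 + a_1 x + ⋯ + a_{n-1} x ^ (n-1)`, this is an ideal; see
`isCyclicCode_iff_exists_ideal` below. -/
def IsCyclicCode (K : Type*) {L : Type*} [Field K] [Field L] [Algebra K L] {n : ℕ}
    (C : Submodule L (Fin n → L)) : Prop :=
  IsMCode (companionMatrix n (X ^ n - 1 : K[X])) C

/-- The proportion, among all cyclic codes of length `n` over `L`, of those whose minimal rank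
distance is different from `1`. -/
noncomputable def cyclicProportion {K L ι : Type*} [Field K] [Field L] [Algebra K L] (n : ℕ)
    (B : Module.Basis ι K L) : ℝ :=
  (Set.ncard {C : Submodule L (Fin n → L) | IsCyclicCode K C ∧ MinRankDistNeOne B C} : ℝ) /
    (Set.ncard {C : Submodule L (Fin n → L) | IsCyclicCode K C} : ℝ)

/-! ### The numerical invariants -/

/-- `o_d(a)`, the multiplicative order of `a` modulo `d`. -/
noncomputable def ordMod (d a : ℕ) : ℕ := orderOf (a : ZMod d)

/-- `t_{d,q} = φ(d) / o_d(q)`; the division is exact, see `tInv_mul`. -/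
noncomputable def tInv (d q : ℕ) : ℕ := Nat.totient d / ordMod d q

/-- `n_{d,q} = o_d(q) / o_d(q ^ m)`; the division is exact, see `nInv_mul`. -/
noncomputable def nInv (m d q : ℕ) : ℕ := ordMod d q / ordMod d (q ^ m)

theorem tInv_mul {d q : ℕ} (hd : 0 < d) (h : Nat.Coprime q d) :
    tInv d q * ordMod d q = Nat.totient d := by
  have : NeZero d := ⟨hd.ne'⟩
  refine Nat.div_mul_cancel ?_
  have h1 : ordMod d q = orderOf (ZMod.unitOfCoprime q h) := by
    rw [ordMod, ← orderOf_units, ZMod.coe_unitOfCoprime]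
  rw [h1, ← ZMod.card_units_eq_totient]
  exact orderOf_dvd_card

theorem nInv_mul (m d q : ℕ) : nInv m d q * ordMod d (q ^ m) = ordMod d q := by
  refine Nat.div_mul_cancel ?_
  rw [ordMod, Nat.cast_pow]
  exact orderOf_pow_dvd m

/-! ### Cyclic codes are the ideals of `L[x] / (x ^ n - 1)` -/

/-- The `L`-linear map `L ^ n → L[x] / (x ^ n - 1)` sending `(a_0, …, a_{n-1})` to the class of
`a_0 + a_1 x + ⋯ + a_{n-1} x ^ (n-1)`. -/
noncomputable def toQuot (L : Type*) [Field L] (n : ℕ) :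
    (Fin n → L) →ₗ[L] AdjoinRoot (X ^ n - 1 : L[X]) :=
  Fintype.linearCombination L fun i : Fin n => AdjoinRoot.root (X ^ n - 1 : L[X]) ^ (i : ℕ)

theorem toQuot_bijective (L : Type*) [Field L] {n : ℕ} (hn : 0 < n) :
    Function.Bijective (toQuot L n) := by
  have hm : (X ^ n - 1 : L[X]).Monic := by simpa using monic_X_pow_sub_C (1 : L) hn.ne'
  have hd : (X ^ n - 1 : L[X]).natDegree = n := by
    simpa using natDegree_X_pow_sub_C (n := n) (r := (1 : L))
  let b := ((AdjoinRoot.powerBasis' hm).basis.reindex (finCongr hd))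
  have hb : ∀ i : Fin n, b i = AdjoinRoot.root (X ^ n - 1 : L[X]) ^ (i : ℕ) := by
    intro i
    simp only [b, Module.Basis.reindex_apply, PowerBasis.coe_basis, AdjoinRoot.powerBasis'_gen]
    rfl
  have : toQuot L n = b.equivFun.symm.toLinearMap := by
    ext i
    simp [toQuot, Fintype.linearCombination_apply, hb]
  rw [this]
  exact b.equivFun.symm.bijective

theorem toQuot_shift {K L : Type*} [Field K] [Field L] [Algebra K L] {n : ℕ} (hn : 0 < n)
    (c : Fin n → L) :
    toQuot L n (Matrix.vecMul c
        ((companionMatrix n (X ^ n - 1 : K[X])).map (algebraMap K L)).transpose) =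
      AdjoinRoot.root (X ^ n - 1 : L[X]) * toQuot L n c := by
  have hroot : AdjoinRoot.root (X ^ n - 1 : L[X]) ^ n = 1 := by
    have h := AdjoinRoot.eval₂_root (X ^ n - 1 : L[X])
    simpa [sub_eq_zero] using h
  have key : toQuot L n ∘ₗ Matrix.vecMulLinear
        ((companionMatrix n (X ^ n - 1 : K[X])).map (algebraMap K L)).transpose =
      LinearMap.mulLeft L (AdjoinRoot.root (X ^ n - 1 : L[X])) ∘ₗ toQuot L n := by
    refine LinearMap.pi_ext' fun i => LinearMap.ext_ring ?_
    simp only [LinearMap.comp_apply, LinearMap.single_apply, Matrix.vecMulLinear_apply,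
      Matrix.single_one_vecMul, LinearMap.mulLeft_apply, toQuot,
      Fintype.linearCombination_apply]
    rw [Finset.sum_eq_single (f := fun k : Fin n => (Pi.single i (1 : L) : Fin n → L) k •
        AdjoinRoot.root (X ^ n - 1 : L[X]) ^ (k : ℕ)) i (fun k _ hk => by simp [hk]) (by simp),
      Pi.single_eq_same, one_smul, ← pow_succ']
    by_cases hi : (i : ℕ) + 1 = n
    · rw [hi, hroot, Finset.sum_eq_single (⟨0, hn⟩ : Fin n)]
      · simp [companionMatrix, hi, hn.ne, hn.ne', coeff_X_pow, coeff_one]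
      · intro k _ hk
        have hk0 : (k : ℕ) ≠ 0 := fun h => hk (Fin.ext h)
        simp [companionMatrix, hi, coeff_X_pow, coeff_one, hk0, k.2.ne]
      · simp
    · rw [Finset.sum_eq_single (⟨i + 1, by omega⟩ : Fin n)]
      · simp [companionMatrix, hi]
      · intro k _ hk
        have hk0 : (k : ℕ) ≠ i + 1 := fun h => hk (Fin.ext h)
        simp [companionMatrix, hi, hk0]
      · simp
  exact LinearMap.congr_fun key c

/-- Cyclic codes of length `n` correspond to the ideals of `L[x] / (x ^ n - 1)`: a code is cyclic
if and only if it is the set of coordinate vectors of an ideal, which is then unique. -/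
theorem isCyclicCode_iff_exists_ideal {K L : Type*} [Field K] [Field L] [Algebra K L] {n : ℕ}
    (hn : 0 < n) (C : Submodule L (Fin n → L)) :
    IsCyclicCode K C ↔ ∃! I : Ideal (AdjoinRoot (X ^ n - 1 : L[X])),
      C = (I.restrictScalars L).comap (toQuot L n) := by
  have hbij := toQuot_bijective L hn
  constructor
  · intro hC
    let J : Submodule L (AdjoinRoot (X ^ n - 1 : L[X])) := C.map (toQuot L n)
    have hroot : ∀ y ∈ J, AdjoinRoot.root (X ^ n - 1 : L[X]) * y ∈ J := by
      rintro _ ⟨c, hc, rfl⟩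
      exact ⟨_, hC c hc, toQuot_shift (K := K) hn c⟩
    have hmul : ∀ p : L[X], ∀ y ∈ J, AdjoinRoot.mk (X ^ n - 1 : L[X]) p * y ∈ J := by
      intro p
      induction p using Polynomial.induction_on' with
      | add p q hp hq =>
        intro y hy
        rw [map_add, add_mul]
        exact J.add_mem (hp y hy) (hq y hy)
      | monomial k a =>
        intro y hy
        have hk : AdjoinRoot.root (X ^ n - 1 : L[X]) ^ k * y ∈ J := by
          induction k with
          | zero => simpa using hy
          | succ k ih =>
            rw [pow_succ', mul_assoc]
            exact hroot _ ih
        have := J.smul_mem a hk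
        rw [← C_mul_X_pow_eq_monomial, map_mul, map_pow, AdjoinRoot.mk_X, AdjoinRoot.mk_C,
          mul_assoc]
        rwa [Algebra.smul_def] at this
    refine ⟨{ carrier := J, add_mem' := J.add_mem, zero_mem' := J.zero_mem,
              smul_mem' := ?_ }, ?_, ?_⟩
    · intro r y hy
      obtain ⟨p, rfl⟩ := AdjoinRoot.mk_surjective r
      exact hmul p y hy
    · change C = J.comap (toQuot L n)
      exact (Submodule.comap_map_eq_of_injective hbij.1 C).symm
    · intro I hI
      ext y
      change y ∈ I ↔ y ∈ J
      obtain ⟨c, rfl⟩ := hbij.2 y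
      have h1 : toQuot L n c ∈ J ↔ c ∈ C :=
        ⟨fun ⟨c', hc', h⟩ => hbij.1 h ▸ hc', fun h => ⟨c, h, rfl⟩⟩
      rw [h1, hI]
      rfl
  · rintro ⟨I, rfl, -⟩ c hc
    change toQuot L n _ ∈ I
    rw [toQuot_shift hn]
    exact I.mul_mem_left _ hc

end RankMetric

open RankMetric

namespace RankMetric

/-! ### Rank weight one and vectors defined over `K`. -/

section RankWeight

variable {K L ι : Type*} [Field K] [Field L] [Algebra K L] {n : ℕ}

/-! A line in `L ^ n` has rank weight one exactly when it is spanned by a vector of `K ^ n`, so the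
minimal rank distance of a code differs from `1` iff the code contains no non-zero vector of `K ^ n`
(`minRankDistNeOne_iff`).

Since `q` and `n` are coprime, `x ^ n - 1` is separable, and cyclic codes correspond to arbitrary
sets `S` of its monic irreducible factors over `L`: the code of `S` consists of the polynomials of
degree below `n` divisible by every member of `S`. Each factor `p` over `L` lies above a unique
factor `f` over `K`, and a polynomial over `K` divisible by `p` is divisible by `f`. Hence the code
contains no non-zero `K`-vector iff `S` meets the fibre above every `f`
(`minRankDistNeOne_codeOfFactors_iff`).

Such an `S` is an independent choice of a non-empty subset of each fibre. If `N_f` is the size of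
the fibre, the proportion is `∏ (1 - 2 ^ (-N_f))` (`cyclicProportion_eq_prod_irredFactors`). For `f`
dividing the `d`-th cyclotomic polynomial, degrees over `K` and `L` are `o_d(q)` and `o_d(q ^ m)`,
so `N_f = n_{d,q}` (`splitNumber_eq_nInv`), and there are `t_{d,q}` such `f`.

The bounds are `1 ≤ N_f ≤ deg f` applied in each factor. All factors being positive, equality of
products means equality in every factor; as `n_{d,q} = gcd(o_d(q), m)` and `o_d(q)` divides
`o_n(q)`, the numerical conditions need only be tested at `d = n`. -/

theorem rankSupport_eq_bot_iff (B : Module.Basis ι K L) (c : Fin n → L) :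
    rankSupport B c = ⊥ ↔ c = 0 := by
  rw [rankSupport, Submodule.span_eq_bot]
  constructor
  · intro h
    funext j
    refine B.repr.map_eq_zero_iff.1 (Finsupp.ext fun i => ?_)
    exact congrFun (h _ ⟨i, rfl⟩) j
  · rintro rfl _ ⟨i, rfl⟩
    funext j
    simp

theorem rankSupport_smul_algebraMap_le (B : Module.Basis ι K L) (v : Fin n → K) (a : L) :
    rankSupport B (a • fun j => algebraMap K L (v j)) ≤ K ∙ v := by
  rw [rankSupport, Submodule.span_le]
  rintro _ ⟨i, rfl⟩
  refine Submodule.mem_span_singleton.2 ⟨B.repr a i, ?_⟩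
  funext j
  have : a * algebraMap K L (v j) = v j • a := by rw [Algebra.smul_def, mul_comm]
  simp [this, mul_comm]

theorem codeRankWeight_span_algebraMap_le (B : Module.Basis ι K L) (v : Fin n → K) :
    codeRankWeight B (L ∙ (fun j => algebraMap K L (v j))) ≤ 1 := by
  have h : codeRankSupport B (L ∙ (fun j => algebraMap K L (v j))) ≤ K ∙ v := by
    refine iSup₂_le fun c hc => ?_
    obtain ⟨a, rfl⟩ := Submodule.mem_span_singleton.1 hc
    exact rankSupport_smul_algebraMap_le B v a
  exact (Submodule.finrank_mono h).trans (by
    simpa using finrank_span_le_card (R := K) ({v} : Set (Fin n → K)))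

theorem codeRankWeight_pos (B : Module.Basis ι K L) {D : Submodule L (Fin n → L)} (hD : D ≠ ⊥) :
    1 ≤ codeRankWeight B D := by
  obtain ⟨c, hc, hc0⟩ := D.ne_bot_iff.1 hD
  rw [Nat.one_le_iff_ne_zero, codeRankWeight, Ne, Submodule.finrank_eq_zero]
  intro h
  refine hc0 ((rankSupport_eq_bot_iff B c).1 ?_)
  rw [eq_bot_iff, ← h]
  exact le_iSup₂ (f := fun c (_ : c ∈ D) => rankSupport B c) c hc

theorem exists_smul_algebraMap_of_rankSupport_le [Finite ι] (B : Module.Basis ι K L)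
    {c : Fin n → L} {v : Fin n → K} (h : rankSupport B c ≤ K ∙ v) :
    ∃ a : L, c = a • fun j => algebraMap K L (v j) := by
  have := Fintype.ofFinite ι
  have hr : ∀ i : ι, ∃ r : K, r • v = fun j => B.repr (c j) i := fun i =>
    Submodule.mem_span_singleton.1 (h (Submodule.subset_span ⟨i, rfl⟩))
  choose r hr using hr
  -- Row `i` of the coordinate matrix is `r i • v`, so `c j = (∑ i, r i • B i) * v j`.
  refine ⟨∑ i, r i • B i, ?_⟩
  funext j
  rw [Pi.smul_apply, smul_eq_mul, Finset.sum_mul, ← B.sum_repr (c j)]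
  refine Finset.sum_congr rfl fun i _ => ?_
  rw [← congrFun (hr i) j, Pi.smul_apply, smul_eq_mul, Algebra.smul_def, Algebra.smul_def,
    map_mul]
  ring

theorem exists_algebraMap_mem_of_codeRankWeight_le_one [Finite ι] (B : Module.Basis ι K L)
    {D : Submodule L (Fin n → L)} (hD : D ≠ ⊥) (h : codeRankWeight B D ≤ 1) :
    ∃ v : Fin n → K, v ≠ 0 ∧ (fun j => algebraMap K L (v j)) ∈ D := by
  obtain ⟨c, hc, hc0⟩ := D.ne_bot_iff.1 hD
  obtain ⟨v, hv⟩ := (Submodule.finrank_le_one_iff_isPrincipal (codeRankSupport B D)).1 h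
  have hle : rankSupport B c ≤ K ∙ v :=
    (le_iSup₂ (f := fun c (_ : c ∈ D) => rankSupport B c) c hc).trans hv.le
  obtain ⟨a, rfl⟩ := exists_smul_algebraMap_of_rankSupport_le B hle
  have ha : a ≠ 0 := by
    rintro rfl
    simp at hc0
  refine ⟨v, ?_, by simpa [smul_smul, ha] using D.smul_mem a⁻¹ hc⟩
  rintro rfl
  exact hc0 (by ext; simp)

/-- `sInf` on `ℕ` is `0` on the empty set; a non-zero code contains a line, so here the infimum is a
genuine minimum. -/
theorem exists_codeRankWeight_eq_genRankWeight_one (B : Module.Basis ι K L)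
    {C : Submodule L (Fin n → L)} (hC : C ≠ ⊥) :
    ∃ D : Submodule L (Fin n → L), D ≤ C ∧ Module.finrank L D = 1 ∧
      codeRankWeight B D = genRankWeight B 1 C := by
  refine Nat.sInf_mem (s := {w | ∃ D : Submodule L (Fin n → L), D ≤ C ∧
    Module.finrank L D = 1 ∧ codeRankWeight B D = w}) ?_
  obtain ⟨c, hc, hc0⟩ := C.ne_bot_iff.1 hC
  exact ⟨_, L ∙ c, by simpa using hc, finrank_span_singleton hc0, rfl⟩

theorem ne_bot_of_finrank_eq_one {D : Submodule L (Fin n → L)} (h : Module.finrank L D = 1) :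
    D ≠ ⊥ := by
  rintro rfl
  simp at h

theorem one_le_genRankWeight_one (B : Module.Basis ι K L) {C : Submodule L (Fin n → L)}
    (hC : C ≠ ⊥) : 1 ≤ genRankWeight B 1 C := by
  obtain ⟨D, -, hD, h⟩ := exists_codeRankWeight_eq_genRankWeight_one B hC
  exact h ▸ codeRankWeight_pos B (ne_bot_of_finrank_eq_one hD)

theorem genRankWeight_one_eq_one_iff (B : Module.Basis ι K L) {C : Submodule L (Fin n → L)}
    (hC : C ≠ ⊥) : genRankWeight B 1 C = 1 ↔ ¬ MinRankDistNeOne B C := by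
  have := one_le_genRankWeight_one B hC
  simp only [MinRankDistNeOne, hC, false_or, ne_eq, not_false_eq_true, true_and]
  omega

theorem minRankDistNeOne_iff [Finite ι] (B : Module.Basis ι K L) (C : Submodule L (Fin n → L)) :
    MinRankDistNeOne B C ↔
      ∀ v : Fin n → K, (fun j => algebraMap K L (v j)) ∈ C → v = 0 := by
  constructor
  · intro h v hv
    by_contra hv0
    have hw : (fun j => algebraMap K L (v j)) ≠ 0 := fun h0 =>
      hv0 (funext fun j => by simpa using congrFun h0 j)
    obtain rfl | ⟨hC, h2⟩ := h
    · exact hw (by simpa using hv)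
    · have h1 : genRankWeight B 1 C ≤ codeRankWeight B (L ∙ (fun j => algebraMap K L (v j))) :=
        Nat.sInf_le ⟨_, by simpa using hv, finrank_span_singleton hw, rfl⟩
      have := codeRankWeight_span_algebraMap_le B v
      omega
  · intro h
    by_contra hne
    have hC : C ≠ ⊥ := fun h0 => hne (Or.inl h0)
    obtain ⟨D, hDC, hD, hw⟩ := exists_codeRankWeight_eq_genRankWeight_one B hC
    rw [(genRankWeight_one_eq_one_iff B hC).2 hne] at hw
    obtain ⟨v, hv0, hv⟩ :=
      exists_algebraMap_mem_of_codeRankWeight_le_one B (ne_bot_of_finrank_eq_one hD) hw.le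
    exact hv0 (h v (hDC hv))

end RankWeight

/-! ### Monic irreducible factors and extension of the base field. -/

section IrredFactors

open UniqueFactorizationMonoid

variable {F : Type*} [Field F]

open Classical in
/-- The finite set of monic irreducible factors of `P`. -/
noncomputable def irredFactors (P : F[X]) : Finset F[X] := (normalizedFactors P).toFinset

theorem mem_irredFactors {P f : F[X]} (hP : P ≠ 0) :
    f ∈ irredFactors P ↔ Irreducible f ∧ f.Monic ∧ f ∣ P := by
  classical
  rw [irredFactors, Multiset.mem_toFinset, Polynomial.mem_normalizedFactors_iff hP]

theorem eq_of_irreducible_of_monic_of_dvd {f g : F[X]} (hf : Irreducible f) (hfm : f.Monic)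
    (hg : Irreducible g) (hgm : g.Monic) (h : f ∣ g) : f = g :=
  eq_of_monic_of_associated hfm hgm (hf.associated_of_dvd hg h)

theorem isCoprime_of_mem_irredFactors {P f g : F[X]} (hP : P ≠ 0) (hf : f ∈ irredFactors P)
    (hg : g ∈ irredFactors P) (h : f ≠ g) : IsCoprime f g := by
  rw [mem_irredFactors hP] at hf hg
  exact hf.1.coprime_iff_not_dvd.2 fun hd =>
    h (eq_of_irreducible_of_monic_of_dvd hf.1 hf.2.1 hg.1 hg.2.1 hd)

theorem associated_prod_irredFactors {P : F[X]} (hP : Squarefree P) :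
    Associated (∏ f ∈ irredFactors P, f) P := by
  classical
  have h0 := hP.ne_zero
  have h := prod_normalizedFactors h0
  have hn := (squarefree_iff_nodup_normalizedFactors h0).1 hP
  rwa [irredFactors, Finset.prod, Multiset.toFinset_val, hn.dedup, Multiset.map_id']

/-- A squarefree polynomial is, up to a unit, the product of its distinct irreducible factors, which
are pairwise coprime. -/
theorem dvd_of_forall_irredFactors_dvd {P Q : F[X]} (hP : Squarefree P)
    (h : ∀ f ∈ irredFactors P, f ∣ Q) : P ∣ Q :=
  (associated_prod_irredFactors hP).symm.dvd.trans
    (Finset.prod_dvd_of_coprime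
      (fun _ hf _ hg hne => isCoprime_of_mem_irredFactors hP.ne_zero hf hg hne) h)

theorem irredFactors_subset {P Q : F[X]} (hQ : Q ≠ 0) (h : P ∣ Q) :
    irredFactors P ⊆ irredFactors Q := by
  intro f hf
  rw [mem_irredFactors (ne_zero_of_dvd_ne_zero hQ h)] at hf
  exact (mem_irredFactors hQ).2 ⟨hf.1, hf.2.1, hf.2.2.trans h⟩

theorem exists_mem_irredFactors_dvd {P : F[X]} (hP : P ≠ 0) (hu : ¬ IsUnit P) :
    ∃ f ∈ irredFactors P, f ∣ P := by
  classical
  obtain ⟨f, hf⟩ := exists_mem_normalizedFactors hP hu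
  exact ⟨f, Multiset.mem_toFinset.2 hf, dvd_of_mem_normalizedFactors hf⟩

/-- In a squarefree polynomial `f * g`, the factor `f` is coprime to `g`. -/
theorem not_dvd_of_squarefree_mul {f g : F[X]} (hf : Irreducible f) (h : Squarefree (f * g)) :
    ¬ f ∣ g := fun hd => hf.not_isUnit (h f (mul_dvd_mul_left f hd))

variable {K L : Type*} [Field K] [Field L] [Algebra K L]

/-- If an irreducible polynomial over `L` divides the images of `f` and `g`, with `f` irreducible
over `K`, then `f` divides `g`. -/
theorem dvd_of_dvd_map_of_dvd_map {f g : K[X]} {p : L[X]} (hf : Irreducible f)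
    (hp : Irreducible p) (h1 : p ∣ f.map (algebraMap K L)) (h2 : p ∣ g.map (algebraMap K L)) :
    f ∣ g := by
  by_contra h
  have hc := (hf.coprime_iff_not_dvd.2 h).map (mapRingHom (algebraMap K L))
  exact hp.not_isUnit (hc.isUnit_of_dvd' (by simpa using h1) (by simpa using h2))

/-- The monic irreducible factor over the base lying below an irreducible factor. -/
theorem exists_mem_irredFactors_dvd_map {P : K[X]} (hP : Squarefree P) {p : L[X]}
    (hp : p ∈ irredFactors (P.map (algebraMap K L))) :
    ∃ f ∈ irredFactors P, p ∣ f.map (algebraMap K L) := by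
  have hP0 : P.map (algebraMap K L) ≠ 0 := Polynomial.map_ne_zero hP.ne_zero
  rw [mem_irredFactors hP0] at hp
  have h : P.map (algebraMap K L) ∣ ∏ f ∈ irredFactors P, f.map (algebraMap K L) := by
    rw [← Polynomial.map_prod]
    exact Polynomial.map_dvd _ (associated_prod_irredFactors hP).symm.dvd
  exact (hp.1.prime.dvd_finsetProd_iff _).1 (hp.2.2.trans h)

theorem eq_of_mem_irredFactors_of_dvd_map {P : K[X]} (hP : P ≠ 0) {p : L[X]} (hp : Irreducible p)
    {f g : K[X]} (hf : f ∈ irredFactors P) (hg : g ∈ irredFactors P)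
    (h1 : p ∣ f.map (algebraMap K L)) (h2 : p ∣ g.map (algebraMap K L)) : f = g := by
  rw [mem_irredFactors hP] at hf hg
  exact eq_of_irreducible_of_monic_of_dvd hf.1 hf.2.1 hg.1 hg.2.1
    (dvd_of_dvd_map_of_dvd_map hf.1 hp h1 h2)

end IrredFactors

/-! ### Cyclic codes as sets of irreducible factors. -/

section Codes

variable {K L : Type*} [Field K] [Field L] [Algebra K L] {n : ℕ}

open Classical in
theorem toQuot_eq_mk_ofFn (c : Fin n → L) :
    toQuot L n c = AdjoinRoot.mk (X ^ n - 1 : L[X]) (ofFn n c) := by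
  rw [ofFn_eq_sum_monomial, map_sum, toQuot, Fintype.linearCombination_apply]
  refine Finset.sum_congr rfl fun i _ => ?_
  rw [← C_mul_X_pow_eq_monomial, map_mul, map_pow, AdjoinRoot.mk_X, AdjoinRoot.mk_C,
    Algebra.smul_def]
  rfl

theorem X_pow_sub_one_ne_zero (hn : 0 < n) : (X ^ n - 1 : L[X]) ≠ 0 := by
  simpa using (monic_X_pow_sub_C (1 : L) hn.ne').ne_zero

theorem natDegree_X_pow_sub_one : (X ^ n - 1 : L[X]).natDegree = n := by
  simpa using natDegree_X_pow_sub_C (n := n) (r := (1 : L))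

open Classical in
-- The ideal pulls back to a principal ideal of `L[X]` containing `X ^ n - 1`; its generator is the
-- `g` sought.
theorem isCyclicCode_iff_exists_dvd (hn : 0 < n) (C : Submodule L (Fin n → L)) :
    IsCyclicCode K C ↔ ∃ g : L[X], g ∣ X ^ n - 1 ∧ ∀ c, c ∈ C ↔ g ∣ ofFn n c := by
  constructor
  · intro h
    obtain ⟨I, hI, -⟩ := (isCyclicCode_iff_exists_ideal hn C).1 h
    let J := I.comap (AdjoinRoot.mk (X ^ n - 1 : L[X]))
    have hJ : ∀ f, f ∈ J ↔ Submodule.IsPrincipal.generator J ∣ f :=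
      fun f => Submodule.IsPrincipal.mem_iff_generator_dvd J
    refine ⟨Submodule.IsPrincipal.generator J, (hJ _).1 ?_, fun c => ?_⟩
    · change AdjoinRoot.mk (X ^ n - 1 : L[X]) _ ∈ I
      simp
    · rw [← hJ, hI]
      change toQuot L n c ∈ I ↔ AdjoinRoot.mk (X ^ n - 1 : L[X]) _ ∈ I
      rw [toQuot_eq_mk_ofFn]
  · rintro ⟨g, hg, hC⟩ c hc
    rw [hC] at hc ⊢
    have h := toQuot_shift (K := K) hn c
    rw [toQuot_eq_mk_ofFn, toQuot_eq_mk_ofFn, ← AdjoinRoot.mk_X, ← map_mul,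
      AdjoinRoot.mk_eq_mk] at h
    -- The shifted word and `X` times the word agree modulo `X ^ n - 1`, hence modulo its divisor
    -- `g`.
    exact (dvd_sub_left (hc.mul_left X)).1 (hg.trans h)

open Classical in
/-- The code of the vectors whose polynomial is divisible by all members of `S`. -/
noncomputable def codeOfFactors (n : ℕ) (S : Set L[X]) : Submodule L (Fin n → L) where
  carrier := {c | ∀ p ∈ S, p ∣ ofFn n c}
  zero_mem' := fun p _ => by simp
  add_mem' := fun ha hb p hp => by
    rw [map_add]
    exact dvd_add (ha p hp) (hb p hp)
  smul_mem' := fun a c hc p hp => by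
    rw [map_smul, smul_eq_C_mul]
    exact (hc p hp).mul_left _

open Classical in
theorem mem_codeOfFactors {S : Set L[X]} {c : Fin n → L} :
    c ∈ codeOfFactors n S ↔ ∀ p ∈ S, p ∣ ofFn n c := Iff.rfl

theorem isCyclicCode_codeOfFactors (hn : 0 < n) {S : Set L[X]}
    (hS : S ⊆ irredFactors (X ^ n - 1 : L[X])) : IsCyclicCode K (codeOfFactors n S) := by
  classical
  intro c hc p hp
  have hpd := ((mem_irredFactors (X_pow_sub_one_ne_zero hn)).1 (hS hp)).2.2
  have h := toQuot_shift (K := K) hn c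
  rw [toQuot_eq_mk_ofFn, toQuot_eq_mk_ofFn, ← AdjoinRoot.mk_X, ← map_mul,
    AdjoinRoot.mk_eq_mk] at h
  exact (dvd_sub_left ((hc p hp).mul_left X)).1 (hpd.trans h)

open Classical in
-- Removing an irreducible factor leaves a cofactor of degree below `n`, which is therefore a word.
-- These cofactors are the test words for separating codes and for finding words over `K`.
theorem exists_ofFn_eq {F : Type*} [Field F] (hn : 0 < n) {f h : F[X]} (hf : Irreducible f)
    (hfh : X ^ n - 1 = f * h) : ∃ c : Fin n → F, ofFn n c = h := by
  have h0 : f * h ≠ 0 := hfh ▸ X_pow_sub_one_ne_zero hn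
  refine ⟨toFn n h, ofFn_comp_toFn_eq_id_of_natDegree_lt ?_⟩
  have := natDegree_mul (left_ne_zero_of_mul h0) (right_ne_zero_of_mul h0)
  rw [← hfh, natDegree_X_pow_sub_one] at this
  have := hf.natDegree_pos
  omega

/-- For `p ∈ S \ T`, the cofactor `(X ^ n - 1) / p` is divisible by every member of `T` but, by
squarefreeness, not by `p`. -/
theorem codeOfFactors_le_imp (hn : 0 < n) (hsq : Squarefree (X ^ n - 1 : L[X])) {S T : Set L[X]}
    (hS : S ⊆ irredFactors (X ^ n - 1 : L[X])) (hT : T ⊆ irredFactors (X ^ n - 1 : L[X]))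
    (h : codeOfFactors n T ≤ codeOfFactors n S) : S ⊆ T := by
  classical
  intro p hp
  by_contra hpT
  have hp1 := (mem_irredFactors hsq.ne_zero).1 (hS hp)
  obtain ⟨g, hg⟩ := hp1.2.2
  obtain ⟨c, hc⟩ := exists_ofFn_eq hn hp1.1 hg
  have hcT : c ∈ codeOfFactors n T := by
    intro r hr
    have hr1 := (mem_irredFactors hsq.ne_zero).1 (hT hr)
    have hco := isCoprime_of_mem_irredFactors hsq.ne_zero (hT hr) (hS hp)
      (fun h => hpT (h ▸ hr))
    rw [hc]
    exact hco.dvd_of_dvd_mul_left (hg ▸ hr1.2.2)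
  have := h hcT p hp
  rw [hc] at this
  exact not_dvd_of_squarefree_mul hp1.1 (hg ▸ hsq) this

theorem injOn_codeOfFactors (hn : 0 < n) (hsq : Squarefree (X ^ n - 1 : L[X])) :
    Set.InjOn (codeOfFactors (L := L) n) {S | S ⊆ irredFactors (X ^ n - 1 : L[X])} :=
  fun _ hS _ hT h => Set.Subset.antisymm (codeOfFactors_le_imp hn hsq hS hT h.ge)
    (codeOfFactors_le_imp hn hsq hT hS h.le)

theorem exists_codeOfFactors_eq (hn : 0 < n) (hsq : Squarefree (X ^ n - 1 : L[X]))
    {C : Submodule L (Fin n → L)} (hC : IsCyclicCode K C) :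
    ∃ S : Set L[X], S ⊆ irredFactors (X ^ n - 1 : L[X]) ∧ codeOfFactors n S = C := by
  classical
  obtain ⟨g, hg, hgC⟩ := (isCyclicCode_iff_exists_dvd hn C).1 hC
  have hgs : Squarefree g := hsq.squarefree_of_dvd hg
  refine ⟨irredFactors g, Finset.coe_subset.2 (irredFactors_subset hsq.ne_zero hg), ?_⟩
  ext c
  rw [hgC, mem_codeOfFactors]
  exact ⟨dvd_of_forall_irredFactors_dvd hgs,
    fun h p hp => ((mem_irredFactors hgs.ne_zero).1 hp).2.2.trans h⟩

open Classical in
theorem ofFn_algebraMap (v : Fin n → K) :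
    ofFn n (fun j => algebraMap K L (v j)) = (ofFn n v).map (algebraMap K L) := by
  simp [ofFn_eq_sum_monomial, Polynomial.map_sum]

theorem map_X_pow_sub_one : (X ^ n - 1 : K[X]).map (algebraMap K L) = X ^ n - 1 := by simp

/-- If `S` has nothing above `f`, then `(X ^ n - 1) / f` is a non-zero word of the code with
coefficients in `K`. Conversely, if `S` meets every fibre, a word over `K` is divisible by every
`f`, hence by `X ^ n - 1`, and vanishes for degree reasons. -/
theorem minRankDistNeOne_codeOfFactors_iff {ι : Type*} [Finite ι] (B : Module.Basis ι K L)
    (hn : 0 < n) (hsqK : Squarefree (X ^ n - 1 : K[X])) {S : Set L[X]}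
    (hS : S ⊆ irredFactors (X ^ n - 1 : L[X])) :
    MinRankDistNeOne B (codeOfFactors n S) ↔
      ∀ f ∈ irredFactors (X ^ n - 1 : K[X]), ∃ p ∈ S, p ∣ f.map (algebraMap K L) := by
  classical
  rw [minRankDistNeOne_iff]
  constructor
  · intro h f hf
    by_contra! hfS
    rw [mem_irredFactors hsqK.ne_zero] at hf
    obtain ⟨g, hg⟩ := hf.2.2
    obtain ⟨v, hv⟩ := exists_ofFn_eq hn hf.1 hg
    have h0 := h v (fun p hp => by
      have hp1 := (mem_irredFactors (X_pow_sub_one_ne_zero hn)).1 (hS hp)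
      rw [ofFn_algebraMap, hv]
      refine (hp1.1.prime.dvd_or_dvd ?_).resolve_left (hfS p hp)
      rw [← Polynomial.map_mul, ← hg, map_X_pow_sub_one]
      exact hp1.2.2)
    rw [h0, map_zero] at hv
    rw [← hv, mul_zero] at hg
    exact hsqK.ne_zero hg
  · intro h v hv
    have hd : X ^ n - 1 ∣ ofFn n v := by
      refine dvd_of_forall_irredFactors_dvd hsqK fun f hf => ?_
      obtain ⟨p, hp, hpf⟩ := h f hf
      have hp1 := (mem_irredFactors (X_pow_sub_one_ne_zero hn)).1 (hS hp)
      have hpv := hv p hp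
      rw [ofFn_algebraMap] at hpv
      exact dvd_of_dvd_map_of_dvd_map ((mem_irredFactors hsqK.ne_zero).1 hf).1 hp1.1 hpf hpv
    refine injective_ofFn n ?_
    rw [map_zero]
    refine eq_zero_of_dvd_of_natDegree_lt hd ?_
    rw [natDegree_X_pow_sub_one]
    exact ofFn_natDegree_lt hn v

end Codes

/-- The number of subsets meeting every fibre of a map. -/
theorem card_sets_meeting_fibres {α β : Type*} [Fintype α] [Fintype β] (π : α → β) :
    Nat.card {S : Set α // ∀ b, ∃ a ∈ S, π a = b} = ∏ b, (2 ^ Nat.card {a // π a = b} - 1) := by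
  classical
  -- A subset amounts to its family of traces on the fibres; meeting every fibre means that each
  -- trace is non-empty.
  let e : Set α ≃ ∀ b, Set {a // π a = b} :=
    (Equiv.arrowCongr (Equiv.sigmaFiberEquiv π).symm (Equiv.refl Prop)).trans
      (Equiv.piCurry fun b (_ : {a // π a = b}) => Prop)
  have he : ∀ (S : Set α) (b : β) (a : {a // π a = b}), a ∈ e S b ↔ a.1 ∈ S :=
    fun S b a => Iff.rfl
  let e' : {S : Set α // ∀ b, ∃ a ∈ S, π a = b} ≃ {T : ∀ b, Set {a // π a = b} // ∀ b, T b ≠ ∅} :=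
    e.subtypeEquiv fun S => forall_congr' fun b => by
      rw [← Set.nonempty_iff_ne_empty]
      constructor
      · rintro ⟨a, ha, hb⟩
        exact ⟨⟨a, hb⟩, (he _ _ _).2 ha⟩
      · rintro ⟨a, ha⟩
        exact ⟨a, (he _ _ _).1 ha, a.2⟩
  rw [Nat.card_congr (e'.trans (Equiv.subtypePiEquivPi (p := fun b (T : Set {a // π a = b}) => T ≠ ∅))), Nat.card_pi]
  refine Finset.prod_congr rfl fun b _ => ?_
  rw [Nat.card_eq_fintype_card, Nat.card_eq_fintype_card, Fintype.card_subtype_compl,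
    Fintype.card_set, Fintype.card_subtype_eq]

theorem card_eq_sum_fibres {α β : Type*} [Fintype α] [Fintype β] (π : α → β) :
    Nat.card α = ∑ b, Nat.card {a // π a = b} := by
  rw [← Nat.card_sigma, Nat.card_congr (Equiv.sigmaFiberEquiv π)]

/-! ### Counting cyclic codes fibre by fibre. -/

section Count

variable {K L : Type*} [Field K] [Field L] [Algebra K L] {n : ℕ}

variable (K) in
-- Keeping `P` as a variable allows it to be the image of `X ^ n - 1` from `K[X]`, so that the index
-- set is literally the domain of `factorBelow`.
theorem ncard_isCyclicCode (hn : 0 < n) {P : L[X]} (hP : P = X ^ n - 1) (hsq : Squarefree P)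
    (Q : Submodule L (Fin n → L) → Prop) :
    Set.ncard {C : Submodule L (Fin n → L) | IsCyclicCode K C ∧ Q C} =
      Nat.card {S : Set (irredFactors P) // Q (codeOfFactors n (Subtype.val '' S))} := by
  subst hP
  have hsub : ∀ S : Set (irredFactors (X ^ n - 1 : L[X])),
      Subtype.val '' S ⊆ (irredFactors (X ^ n - 1 : L[X]) : Set L[X]) := by
    rintro S _ ⟨p, -, rfl⟩
    exact p.2
  symm
  refine Nat.card_congr (Equiv.ofBijective (fun S => ⟨codeOfFactors n (Subtype.val '' S.1),
    isCyclicCode_codeOfFactors hn (hsub S.1), S.2⟩) ⟨?_, ?_⟩)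
  · intro S T h
    exact Subtype.ext (Subtype.val_injective.image_injective
      (injOn_codeOfFactors hn hsq (hsub S.1) (hsub T.1) (congrArg Subtype.val h)))
  · rintro ⟨C, hC, hQ⟩
    obtain ⟨S, hS, rfl⟩ := exists_codeOfFactors_eq hn hsq hC
    have : Subtype.val '' (Subtype.val ⁻¹' S : Set (irredFactors (X ^ n - 1 : L[X]))) = S :=
      Set.image_preimage_eq_of_subset (by simpa using hS)
    exact ⟨⟨Subtype.val ⁻¹' S, by rwa [this]⟩, Subtype.ext (by simp only [this])⟩

variable (L) in
/-- The number of monic irreducible factors over `L` of a polynomial over `K`. -/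
noncomputable def splitNumber (f : K[X]) : ℕ := (irredFactors (f.map (algebraMap K L))).card

/-- The factor over `K` below an irreducible factor over `L`. -/
noncomputable def factorBelow {P : K[X]} (hP : Squarefree P)
    (p : irredFactors (P.map (algebraMap K L))) : irredFactors P :=
  ⟨(exists_mem_irredFactors_dvd_map hP p.2).choose,
    (exists_mem_irredFactors_dvd_map hP p.2).choose_spec.1⟩

/-- The chosen factor is the only possible one: two distinct irreducible factors over `K` are
coprime, and remain so over `L`. -/
theorem factorBelow_eq_iff {P : K[X]} (hP : Squarefree P)
    (p : irredFactors (P.map (algebraMap K L))) (f : irredFactors P) :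
    factorBelow hP p = f ↔ p.1 ∣ f.1.map (algebraMap K L) := by
  have hs := (exists_mem_irredFactors_dvd_map hP p.2).choose_spec
  have hp := ((mem_irredFactors (Polynomial.map_ne_zero hP.ne_zero)).1 p.2).1
  constructor
  · rintro rfl
    exact hs.2
  · intro h
    exact Subtype.ext (eq_of_mem_irredFactors_of_dvd_map hP.ne_zero hp hs.1 f.2 hs.2 h)

theorem card_factorBelow_fibre {P : K[X]} (hP : Squarefree P) (f : irredFactors P) :
    Nat.card {p : irredFactors (P.map (algebraMap K L)) // factorBelow hP p = f} =
      splitNumber L f.1 := by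
  have hf := (mem_irredFactors hP.ne_zero).1 f.2
  have hsub := irredFactors_subset (Polynomial.map_ne_zero hP.ne_zero)
    (Polynomial.map_dvd (algebraMap K L) hf.2.2)
  rw [splitNumber, ← Fintype.card_coe, ← Nat.card_eq_fintype_card]
  refine Nat.card_congr ((Equiv.subtypeEquivRight fun p => factorBelow_eq_iff hP p f).trans
    { toFun := fun p => ⟨p.1.1, ?_⟩
      invFun := fun p => ⟨⟨p.1, hsub p.2⟩, ?_⟩
      left_inv := fun p => rfl
      right_inv := fun p => rfl })
  · have hp := (mem_irredFactors (Polynomial.map_ne_zero hP.ne_zero)).1 p.1.2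
    exact (mem_irredFactors (Polynomial.map_ne_zero hf.1.ne_zero)).2 ⟨hp.1, hp.2.1, p.2⟩
  · exact ((mem_irredFactors (Polynomial.map_ne_zero hf.1.ne_zero)).1 p.2).2.2

theorem ncard_cyclicCodes (hn : 0 < n) (hsq : (X ^ n - 1 : K[X]).Separable) :
    Set.ncard {C : Submodule L (Fin n → L) | IsCyclicCode K C} =
      ∏ f ∈ irredFactors (X ^ n - 1 : K[X]), 2 ^ splitNumber L f := by
  have h := ncard_isCyclicCode K hn (map_X_pow_sub_one (K := K)) (L := L) hsq.map.squarefree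
    (fun _ => True)
  simp only [and_true] at h
  rw [h, Nat.card_congr (Equiv.subtypeUnivEquiv fun _ => trivial), Nat.card_eq_fintype_card,
    Fintype.card_set, ← Nat.card_eq_fintype_card, card_eq_sum_fibres (factorBelow hsq.squarefree),
    ← Finset.prod_pow_eq_pow_sum,
    ← Finset.prod_coe_sort (irredFactors (X ^ n - 1 : K[X]))]
  simp only [card_factorBelow_fibre]

theorem ncard_cyclicCodes_minRankDistNeOne {ι : Type*} [Finite ι] (B : Module.Basis ι K L)
    (hn : 0 < n) (hsq : (X ^ n - 1 : K[X]).Separable) :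
    Set.ncard {C : Submodule L (Fin n → L) | IsCyclicCode K C ∧ MinRankDistNeOne B C} =
      ∏ f ∈ irredFactors (X ^ n - 1 : K[X]), (2 ^ splitNumber L f - 1) := by
  rw [ncard_isCyclicCode K hn (map_X_pow_sub_one (K := K)) (L := L) hsq.map.squarefree,
    ← Finset.prod_coe_sort]
  simp only [← card_factorBelow_fibre (L := L) hsq.squarefree]
  rw [← card_sets_meeting_fibres]
  refine Nat.card_congr (Equiv.subtypeEquivRight fun S => ?_)
  rw [minRankDistNeOne_codeOfFactors_iff B hn hsq.squarefree]
  · simp [factorBelow_eq_iff]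
  · rintro _ ⟨p, -, rfl⟩
    simpa using p.2

theorem splitNumber_pos {f : K[X]} (hf : Irreducible f) : 0 < splitNumber L f := by
  obtain ⟨p, hp, -⟩ := exists_mem_irredFactors_dvd
    (Polynomial.map_ne_zero (f := algebraMap K L) hf.ne_zero)
    (fun h => hf.not_isUnit ((isUnit_map (algebraMap K L)).1 h))
  exact Finset.card_pos.2 ⟨p, hp⟩

/-- Separability survives extension of scalars, so the image is squarefree; having a single
irreducible factor then forces it to be associated to that factor. -/
theorem irreducible_map_iff_splitNumber {f : K[X]} (hf : Irreducible f) (hfm : f.Monic)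
    (hs : f.Separable) : Irreducible (f.map (algebraMap K L)) ↔ splitNumber L f = 1 := by
  have h0 : f.map (algebraMap K L) ≠ 0 := Polynomial.map_ne_zero hf.ne_zero
  constructor
  · intro h
    refine Finset.card_eq_one.2 ⟨f.map (algebraMap K L), ?_⟩
    ext p
    rw [mem_irredFactors h0, Finset.mem_singleton]
    constructor
    · rintro ⟨hp, hpm, hd⟩
      exact eq_of_irreducible_of_monic_of_dvd hp hpm h (hfm.map _) hd
    · rintro rfl
      exact ⟨h, hfm.map _, dvd_rfl⟩
  · intro h
    obtain ⟨p, hp⟩ := Finset.card_eq_one.1 h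
    have ha := associated_prod_irredFactors (hs.map (f := algebraMap K L)).squarefree
    rw [hp, Finset.prod_singleton] at ha
    have hpm : p ∈ irredFactors (f.map (algebraMap K L)) := by simp [hp]
    exact ha.irreducible ((mem_irredFactors h0).1 hpm).1

theorem cyclicProportion_eq_prod_irredFactors {ι : Type*} [Finite ι] (B : Module.Basis ι K L)
    (hn : 0 < n) (hsq : (X ^ n - 1 : K[X]).Separable) :
    cyclicProportion n B =
      ∏ f ∈ irredFactors (X ^ n - 1 : K[X]), (1 - 1 / (2 : ℝ) ^ splitNumber L f) := by
  rw [cyclicProportion, ncard_cyclicCodes_minRankDistNeOne B hn hsq, ncard_cyclicCodes hn hsq,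
    Nat.cast_prod, Nat.cast_prod, ← Finset.prod_div_distrib]
  refine Finset.prod_congr rfl fun f _ => ?_
  rw [Nat.cast_sub Nat.one_le_two_pow]
  push_cast
  rw [sub_div, div_self (by positivity)]

/-- The zero code always counts in the numerator. The left side says that it is alone there, that
is, `∏ (2 ^ N_f - 1) = 1`, which forces every `N_f = 1`. -/
theorem forall_genRankWeight_one_eq_one_iff {ι : Type*} [Finite ι] (B : Module.Basis ι K L)
    (hn : 0 < n) (hsq : (X ^ n - 1 : K[X]).Separable) :
    (∀ C : Submodule L (Fin n → L), IsCyclicCode K C → C ≠ ⊥ → genRankWeight B 1 C = 1) ↔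
      ∀ f ∈ irredFactors (X ^ n - 1 : K[X]), splitNumber L f = 1 := by
  have hbot : (⊥ : Submodule L (Fin n → L)) ∈
      {C : Submodule L (Fin n → L) | IsCyclicCode K C ∧ MinRankDistNeOne B C} :=
    ⟨fun c hc => by simp [(Submodule.mem_bot L).1 hc], Or.inl rfl⟩
  have h1 : (∀ C : Submodule L (Fin n → L), IsCyclicCode K C → C ≠ ⊥ → genRankWeight B 1 C = 1) ↔
      {C : Submodule L (Fin n → L) | IsCyclicCode K C ∧ MinRankDistNeOne B C} = {⊥} := by
    constructor
    · intro h
      refine Set.eq_singleton_iff_unique_mem.2 ⟨hbot, fun C hC => ?_⟩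
      by_contra h0
      exact (genRankWeight_one_eq_one_iff B h0).1 (h C hC.1 h0) hC.2
    · intro h C hC h0
      refine (genRankWeight_one_eq_one_iff B h0).2 fun hw => h0 ?_
      have : C ∈ {C : Submodule L (Fin n → L) | IsCyclicCode K C ∧ MinRankDistNeOne B C} :=
        ⟨hC, hw⟩
      rwa [h] at this
  have h2 : Set.ncard {C : Submodule L (Fin n → L) | IsCyclicCode K C ∧ MinRankDistNeOne B C} = 1 ↔
      {C : Submodule L (Fin n → L) | IsCyclicCode K C ∧ MinRankDistNeOne B C} = {⊥} := by
    rw [Set.ncard_eq_one]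
    constructor
    · rintro ⟨C, hC⟩
      rw [hC] at hbot ⊢
      rw [Set.mem_singleton_iff.1 hbot]
    · exact fun h => ⟨_, h⟩
  rw [h1, ← h2, ncard_cyclicCodes_minRankDistNeOne B hn hsq, Finset.prod_eq_one_iff]
  refine forall₂_congr fun f _ => ?_
  constructor
  · intro h
    have : 2 ^ splitNumber L f = 2 ^ 1 := by omega
    exact Nat.pow_right_injective le_rfl this
  · intro h
    simp [h]

end Count

/-! ### Multiplicative orders modulo divisors of `n`. -/

section Orders

theorem ordMod_pos {d q : ℕ} (hd : 0 < d) (h : q.Coprime d) : 0 < ordMod d q := by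
  have : NeZero d := ⟨hd.ne'⟩
  rw [ordMod, ← ZMod.coe_unitOfCoprime q h, orderOf_units]
  exact orderOf_pos _

theorem ordMod_dvd_ordMod {d n : ℕ} (q : ℕ) (h : d ∣ n) : ordMod d q ∣ ordMod n q := by
  have := orderOf_map_dvd (ZMod.castHom h (ZMod d)).toMonoidHom (q : ZMod n)
  simpa [ordMod] using this

/-- In gcd form, the extreme values `1` and `o_d(q)` become coprimality with `m` and divisibility of
`m`. -/
theorem nInv_eq_gcd {d q : ℕ} (m : ℕ) (hd : 0 < d) (h : q.Coprime d) :
    nInv m d q = Nat.gcd (ordMod d q) m := by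
  have h0 := ordMod_pos hd h
  have h1 : ordMod d (q ^ m) = ordMod d q / Nat.gcd (ordMod d q) m := by
    rw [ordMod, Nat.cast_pow, IsOfFinOrder.orderOf_pow _ _ (orderOf_pos_iff.1 h0)]
    rfl
  rw [nInv, h1, Nat.div_div_self (Nat.gcd_dvd_left _ _) h0.ne']

theorem forall_nInv_eq_one_iff {n q : ℕ} (m : ℕ) (hn : 0 < n) (h : q.Coprime n) :
    (∀ d ∈ n.divisors, nInv m d q = 1) ↔ Nat.gcd m (ordMod n q) = 1 := by
  constructor
  · intro hd
    rw [Nat.gcd_comm, ← nInv_eq_gcd m hn h]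
    exact hd n (Nat.mem_divisors_self n hn.ne')
  · intro hg d hd
    have hdn := Nat.dvd_of_mem_divisors hd
    rw [nInv_eq_gcd m (Nat.pos_of_mem_divisors hd) (h.coprime_dvd_right hdn)]
    exact (Nat.Coprime.coprime_dvd_right (ordMod_dvd_ordMod q hdn) hg).symm

theorem forall_nInv_eq_ordMod_iff {n q : ℕ} (m : ℕ) (hn : 0 < n) (h : q.Coprime n) :
    (∀ d ∈ n.divisors, nInv m d q = ordMod d q) ↔ ordMod n q ∣ m := by
  constructor
  · intro hd
    have := hd n (Nat.mem_divisors_self n hn.ne')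
    rwa [nInv_eq_gcd m hn h, Nat.gcd_eq_left_iff_dvd] at this
  · intro hg d hd
    have hdn := Nat.dvd_of_mem_divisors hd
    rw [nInv_eq_gcd m (Nat.pos_of_mem_divisors hd) (h.coprime_dvd_right hdn),
      Nat.gcd_eq_left_iff_dvd]
    exact (ordMod_dvd_ordMod q hdn).trans hg

theorem ordMod_pow_eq_one_iff {d q m : ℕ} : ordMod d (q ^ m) = 1 ↔ ordMod d q ∣ m := by
  rw [ordMod, orderOf_eq_one_iff, Nat.cast_pow, ordMod, orderOf_dvd_iff_pow_eq_one]

end Orders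

/-! ### Factorization of `x ^ n - 1` over a finite field. -/

section FiniteField

variable {F : Type*} [Field F]

theorem card_irredFactors_mul {P : F[X]} (hP : Squarefree P) {e : ℕ}
    (h : ∀ f ∈ irredFactors P, f.natDegree = e) : (irredFactors P).card * e = P.natDegree := by
  rw [← natDegree_eq_of_degree_eq (degree_eq_degree_of_associated (associated_prod_irredFactors hP)),
    natDegree_prod _ _ fun f hf => ((mem_irredFactors hP.ne_zero).1 hf).1.ne_zero,
    Finset.sum_congr rfl h, Finset.sum_const, smul_eq_mul]

/-- Squarefreeness makes the factor sets of the different `P i` disjoint. -/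
theorem prod_irredFactors_prod {ι M : Type*} [CommMonoid M] {s : Finset ι} {P : ι → F[X]}
    (hP : Squarefree (∏ i ∈ s, P i)) (g : F[X] → M) :
    ∏ f ∈ irredFactors (∏ i ∈ s, P i), g f = ∏ i ∈ s, ∏ f ∈ irredFactors (P i), g f := by
  classical
  have h0 : ∀ i ∈ s, P i ≠ 0 := Finset.prod_ne_zero_iff.1 hP.ne_zero
  rw [← Finset.prod_biUnion]
  · refine Finset.prod_congr ?_ fun _ _ => rfl
    ext f
    rw [mem_irredFactors hP.ne_zero, Finset.mem_biUnion]
    constructor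
    · rintro ⟨hf, hfm, hd⟩
      obtain ⟨i, hi, hfi⟩ := (hf.prime.dvd_finsetProd_iff _).1 hd
      exact ⟨i, hi, (mem_irredFactors (h0 i hi)).2 ⟨hf, hfm, hfi⟩⟩
    · rintro ⟨i, hi, hf⟩
      rw [mem_irredFactors (h0 i hi)] at hf
      exact ⟨hf.1, hf.2.1, hf.2.2.trans (Finset.dvd_prod_of_mem P hi)⟩
  · intro i hi j hj hij
    refine Finset.disjoint_left.2 fun f hfi hfj => ?_
    rw [mem_irredFactors (h0 i hi)] at hfi
    rw [mem_irredFactors (h0 j hj)] at hfj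
    rw [← Finset.mul_prod_erase s P hi] at hP
    exact hfi.1.not_isUnit (hP f (mul_dvd_mul hfi.2.2
      (hfj.2.2.trans (Finset.dvd_prod_of_mem P (Finset.mem_erase.2 ⟨hij.symm, hj⟩)))))

theorem prod_irredFactors_X_pow_sub_one {M : Type*} [CommMonoid M] {n : ℕ} (hn : 0 < n)
    (hsq : Squarefree (X ^ n - 1 : F[X])) (g : F[X] → M) :
    ∏ f ∈ irredFactors (X ^ n - 1 : F[X]), g f =
      ∏ d ∈ n.divisors, ∏ f ∈ irredFactors (cyclotomic d F), g f := by
  rw [← prod_cyclotomic_eq_X_pow_sub_one hn] at hsq ⊢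
  exact prod_irredFactors_prod hsq g

theorem exists_mem_irredFactors_cyclotomic {n : ℕ} (hn : 0 < n) {f : F[X]}
    (hf : f ∈ irredFactors (X ^ n - 1 : F[X])) :
    ∃ d ∈ n.divisors, f ∈ irredFactors (cyclotomic d F) := by
  rw [mem_irredFactors (X_pow_sub_one_ne_zero hn)] at hf
  have hd := hf.2.2
  rw [← prod_cyclotomic_eq_X_pow_sub_one hn] at hd
  obtain ⟨d, hdn, hfd⟩ := (hf.1.prime.dvd_finsetProd_iff _).1 hd
  exact ⟨d, hdn, (mem_irredFactors (cyclotomic_ne_zero d F)).2 ⟨hf.1, hf.2.1, hfd⟩⟩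

theorem cyclotomic_dvd_X_pow_sub_one {d n : ℕ} (hd : d ∈ n.divisors) :
    cyclotomic d F ∣ X ^ n - 1 := by
  rw [← prod_cyclotomic_eq_X_pow_sub_one (Nat.pos_of_ne_zero (Nat.mem_divisors.1 hd).2)]
  exact Finset.dvd_prod_of_mem _ hd

/-- A root of `f` is a primitive `d`-th root of unity, and its degree is the length of its orbit
under the Frobenius `ζ ↦ ζ ^ q`. -/
theorem natDegree_of_mem_irredFactors_cyclotomic [Finite F] {d : ℕ}
    (hd : (Nat.card F).Coprime d) {f : F[X]} (hf : f ∈ irredFactors (cyclotomic d F)) :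
    f.natDegree = ordMod d (Nat.card F) := by
  have := Fintype.ofFinite F
  rw [mem_irredFactors (cyclotomic_ne_zero d F)] at hf
  obtain ⟨p, -, k, hp, hk⟩ := FiniteField.card' F
  have : Fact p.Prime := ⟨hp⟩
  rw [Nat.card_eq_fintype_card, hk] at hd ⊢
  have hpd : p.Coprime d := Nat.Coprime.coprime_dvd_left (dvd_pow_self p k.ne_zero) hd
  rw [natDegree_of_dvd_cyclotomic_of_irreducible hk hpd hf.2.2 hf.1, ordMod, ← orderOf_units,
    ZMod.coe_unitOfCoprime]

theorem separable_X_pow_sub_one [Finite F] {n : ℕ} (h : (Nat.card F).Coprime n) :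
    (X ^ n - 1 : F[X]).Separable := by
  have := Fintype.ofFinite F
  rw [X_pow_sub_one_separable_iff]
  obtain ⟨p, hc, k, hp, hk⟩ := FiniteField.card' F
  rw [Ne, CharP.cast_eq_zero_iff F p, ← hp.coprime_iff_not_dvd]
  rw [Nat.card_eq_fintype_card, hk] at h
  exact Nat.Coprime.coprime_dvd_left (dvd_pow_self p k.ne_zero) h

theorem squarefree_cyclotomic_of_coprime [Finite F] {d : ℕ} (hd : 0 < d)
    (h : (Nat.card F).Coprime d) : Squarefree (cyclotomic d F) :=
  (separable_X_pow_sub_one h).squarefree.squarefree_of_dvd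
    (cyclotomic_dvd_X_pow_sub_one (Nat.mem_divisors_self d hd.ne'))

/-- Distinct factors of common degree `o_d(q)` have total degree `φ(d)`. -/
theorem card_irredFactors_cyclotomic [Finite F] {d : ℕ} (hd : 0 < d)
    (h : (Nat.card F).Coprime d) :
    (irredFactors (cyclotomic d F)).card = tInv d (Nat.card F) := by
  have h1 := card_irredFactors_mul (squarefree_cyclotomic_of_coprime hd h)
    fun f hf => natDegree_of_mem_irredFactors_cyclotomic h hf
  rw [natDegree_cyclotomic, ← tInv_mul hd h] at h1
  exact Nat.eq_of_mul_eq_mul_right (ordMod_pos hd h) h1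

/-- Converts products over irreducible factors, where the comparisons are made, into products over
divisors `d` with exponents `t_{d,q}`. -/
theorem prod_irredFactors_X_pow_sub_one_of_const [Finite F] {M : Type*} [CommMonoid M] {n : ℕ}
    (hn : 0 < n) (h : (Nat.card F).Coprime n) (g : F[X] → M) (a : ℕ → M)
    (ha : ∀ d ∈ n.divisors, ∀ f ∈ irredFactors (cyclotomic d F), g f = a d) :
    ∏ f ∈ irredFactors (X ^ n - 1 : F[X]), g f =
      ∏ d ∈ n.divisors, a d ^ tInv d (Nat.card F) := by
  rw [prod_irredFactors_X_pow_sub_one hn (separable_X_pow_sub_one h).squarefree]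
  refine Finset.prod_congr rfl fun d hd => ?_
  rw [Finset.prod_congr rfl (ha d hd), Finset.prod_const, card_irredFactors_cyclotomic
    (Nat.pos_of_mem_divisors hd) (h.coprime_dvd_right (Nat.dvd_of_mem_divisors hd))]

theorem exists_mem_irredFactors_cyclotomic_self {d : ℕ} (hd : 0 < d) :
    ∃ f, f ∈ irredFactors (cyclotomic d F) := by
  obtain ⟨f, hf, -⟩ := exists_mem_irredFactors_dvd (cyclotomic_ne_zero d F)
    (not_isUnit_of_natDegree_pos _ (by rw [natDegree_cyclotomic]; exact Nat.totient_pos.2 hd))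
  exact ⟨f, hf⟩

theorem forall_mem_irredFactors_X_pow_sub_one_iff {n : ℕ} (hn : 0 < n)
    {p : F[X] → Prop} {r : ℕ → Prop}
    (h : ∀ d ∈ n.divisors, ∀ f ∈ irredFactors (cyclotomic d F), p f ↔ r d) :
    (∀ f ∈ irredFactors (X ^ n - 1 : F[X]), p f) ↔ ∀ d ∈ n.divisors, r d := by
  constructor
  · intro hp d hd
    obtain ⟨f, hf⟩ := exists_mem_irredFactors_cyclotomic_self (F := F)
      (Nat.pos_of_mem_divisors hd)
    exact (h d hd f hf).1 (hp f (irredFactors_subset (X_pow_sub_one_ne_zero hn)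
      (cyclotomic_dvd_X_pow_sub_one hd) hf))
  · intro hr f hf
    obtain ⟨d, hd, hfd⟩ := exists_mem_irredFactors_cyclotomic hn hf
    exact (h d hd f hfd).2 (hr d hd)

theorem splits_X_pow_sub_one_iff [Finite F] {n : ℕ} (hn : 0 < n)
    (h : (Nat.card F).Coprime n) :
    (X ^ n - 1 : F[X]).Splits ↔ ordMod n (Nat.card F) = 1 := by
  have hc : ∀ d ∈ n.divisors, (Nat.card F).Coprime d :=
    fun d hd => h.coprime_dvd_right (Nat.dvd_of_mem_divisors hd)
  have h1 : (∀ f ∈ irredFactors (X ^ n - 1 : F[X]), f.natDegree = 1) ↔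
      ∀ d ∈ n.divisors, ordMod d (Nat.card F) = 1 :=
    forall_mem_irredFactors_X_pow_sub_one_iff hn fun d hd f hf => by
      rw [natDegree_of_mem_irredFactors_cyclotomic (hc d hd) hf]
  have h2 : (∀ d ∈ n.divisors, ordMod d (Nat.card F) = 1) ↔ ordMod n (Nat.card F) = 1 := by
    refine ⟨fun hd => hd n (Nat.mem_divisors_self n hn.ne'), fun h1 d hd => ?_⟩
    exact Nat.dvd_one.1 (h1 ▸ ordMod_dvd_ordMod _ (Nat.dvd_of_mem_divisors hd))
  rw [← h2, ← h1]
  have h0 := X_pow_sub_one_ne_zero (L := F) hn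
  constructor
  · intro hs f hf
    rw [mem_irredFactors h0] at hf
    exact (hs.of_dvd h0 hf.2.2).natDegree_eq_one_of_irreducible hf.1
  · intro hf
    have ha := associated_prod_irredFactors (separable_X_pow_sub_one h).squarefree
    refine Splits.of_dvd ?_ (ha.symm.ne_zero_iff.1 h0) ha.symm.dvd
    exact Splits.prod fun f hfm => Splits.of_natDegree_eq_one (hf f hfm)

end FiniteField

/-! ### Splitting of cyclotomic factors in the extension. -/

section SplitNumber

variable {K L : Type*} [Field K] [Field L] [Algebra K L]

theorem splitNumber_eq_nInv [Finite K] [Finite L] {d : ℕ} (hd : 0 < d)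
    (h : (Nat.card K).Coprime d) {m : ℕ} (hL : Nat.card L = Nat.card K ^ m) {f : K[X]}
    (hf : f ∈ irredFactors (cyclotomic d K)) : splitNumber L f = nInv m d (Nat.card K) := by
  have hcL : (Nat.card L).Coprime d := hL ▸ h.pow_left m
  have hdeg := natDegree_of_mem_irredFactors_cyclotomic h hf
  have hfd : f.map (algebraMap K L) ∣ cyclotomic d L := by
    rw [← map_cyclotomic d (algebraMap K L)]
    exact Polynomial.map_dvd _ ((mem_irredFactors (cyclotomic_ne_zero d K)).1 hf).2.2
  have hs := (squarefree_cyclotomic_of_coprime hd hcL).squarefree_of_dvd hfd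
  have h1 := card_irredFactors_mul hs fun p hp => natDegree_of_mem_irredFactors_cyclotomic hcL
    (irredFactors_subset (cyclotomic_ne_zero d L) hfd hp)
  -- Every factor of `f` over `L` has degree `o_d(q ^ m)`, and these degrees add up to `deg f =
  -- o_d(q)`.
  rw [natDegree_map, hdeg, hL, ← nInv_mul m d (Nat.card K)] at h1
  exact Nat.eq_of_mul_eq_mul_right (ordMod_pos hd (h.pow_left m)) h1

end SplitNumber

/-! ### Comparing positive products factor by factor. -/

theorem prod_eq_prod_iff_of_le {ι : Type*} {s : Finset ι} {a b : ι → ℝ} (ha : ∀ i ∈ s, 0 < a i)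
    (hab : ∀ i ∈ s, a i ≤ b i) : ∏ i ∈ s, a i = ∏ i ∈ s, b i ↔ ∀ i ∈ s, a i = b i := by
  refine ⟨fun h => ?_, fun h => Finset.prod_congr rfl h⟩
  by_contra! hne
  obtain ⟨i, hi, hne⟩ := hne
  exact (Finset.prod_lt_prod ha hab ⟨i, hi, lt_of_le_of_ne (hab i hi) hne⟩).ne h

theorem one_sub_one_div_two_pow_le_iff {a b : ℕ} :
    1 - 1 / (2 : ℝ) ^ a ≤ 1 - 1 / (2 : ℝ) ^ b ↔ a ≤ b := by
  rw [sub_le_sub_iff_left, one_div_le_one_div (by positivity) (by positivity),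
    pow_le_pow_iff_right₀ one_lt_two]

theorem one_sub_one_div_two_pow_inj {a b : ℕ} :
    1 - 1 / (2 : ℝ) ^ a = 1 - 1 / (2 : ℝ) ^ b ↔ a = b := by
  simp only [le_antisymm_iff, one_sub_one_div_two_pow_le_iff]

theorem one_sub_one_div_two_pow_pos {a : ℕ} (ha : 0 < a) : 0 < 1 - 1 / (2 : ℝ) ^ a := by
  have : 1 - 1 / (2 : ℝ) ^ 1 ≤ 1 - 1 / (2 : ℝ) ^ a := one_sub_one_div_two_pow_le_iff.2 ha
  norm_num at this ⊢
  linarith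

end RankMetric

/-- Here `K = 𝔽_q` and `L = 𝔽_{q^m}`, with `B` an arbitrary `K`-basis of `L`, used to express
rank supports. -/
theorem mainTheorem10 {K L : Type*} [Field K] [Finite K] [Field L] [Algebra K L]
    (q m n : ℕ) (hq : Nat.card K = q) (B : Module.Basis (Fin m) K L)
    (hn : 0 < n) (hqn : Nat.gcd q n = 1)
    (s : ℕ) (hs : s = ∑ d ∈ n.divisors, tInv d q) :
    -- the value of the proportion
    cyclicProportion n B = ∏ d ∈ n.divisors, (1 - 1 / (2 : ℝ) ^ nInv m d q) ^ tInv d q ∧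
    -- the bounds
    1 / (2 : ℝ) ^ s ≤ cyclicProportion n B ∧
    cyclicProportion n B ≤
      ∏ d ∈ n.divisors, (1 - 1 / (2 : ℝ) ^ ordMod d q) ^ tInv d q ∧
    -- the cases of equality in the lower bound
    (cyclicProportion n B = 1 / (2 : ℝ) ^ s ↔ Nat.gcd m (ordMod n q) = 1) ∧
    (cyclicProportion n B = 1 / (2 : ℝ) ^ s ↔
      ∀ f : K[X], f.Monic → Irreducible f → f ∣ X ^ n - 1 →
        Irreducible (f.map (algebraMap K L))) ∧
    (cyclicProportion n B = 1 / (2 : ℝ) ^ s ↔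
      ∀ C : Submodule L (Fin n → L), IsCyclicCode K C → C ≠ ⊥ → genRankWeight B 1 C = 1) ∧
    -- the cases of equality in the upper bound
    (cyclicProportion n B = ∏ d ∈ n.divisors, (1 - 1 / (2 : ℝ) ^ ordMod d q) ^ tInv d q ↔
      ordMod n q ∣ m) ∧
    (cyclicProportion n B = ∏ d ∈ n.divisors, (1 - 1 / (2 : ℝ) ^ ordMod d q) ^ tInv d q ↔
      ((X ^ n - 1 : K[X]).map (algebraMap K L)).Splits) := by
  subst hq
  have : Module.Finite K L := Module.Finite.of_basis B
  have : Finite L := Module.finite_of_finite K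
  have hL : Nat.card L = Nat.card K ^ m := by
    rw [Module.natCard_eq_pow_finrank (K := K), Module.finrank_eq_card_basis B, Fintype.card_fin]
  have hc : ∀ d ∈ n.divisors, (Nat.card K).Coprime d :=
    fun d hd => Nat.Coprime.coprime_dvd_right (Nat.dvd_of_mem_divisors hd) hqn
  have hsep := separable_X_pow_sub_one (F := K) hqn
  have hsplit : ∀ d ∈ n.divisors, ∀ f ∈ irredFactors (cyclotomic d K),
      splitNumber L f = nInv m d (Nat.card K) := fun d hd f hf =>
    splitNumber_eq_nInv (Nat.pos_of_mem_divisors hd) (hc d hd) hL hf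
  have hdeg : ∀ d ∈ n.divisors, ∀ f ∈ irredFactors (cyclotomic d K),
      f.natDegree = ordMod d (Nat.card K) := fun d hd f hf =>
    natDegree_of_mem_irredFactors_cyclotomic (hc d hd) hf
  have hpos : ∀ f ∈ irredFactors (X ^ n - 1 : K[X]), 1 ≤ splitNumber L f := fun f hf =>
    splitNumber_pos ((mem_irredFactors (X_pow_sub_one_ne_zero hn)).1 hf).1
  have hle : ∀ f ∈ irredFactors (X ^ n - 1 : K[X]), splitNumber L f ≤ f.natDegree := by
    intro f hf
    obtain ⟨d, hd, hfd⟩ := exists_mem_irredFactors_cyclotomic hn hf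
    rw [hsplit d hd f hfd, hdeg d hd f hfd]
    exact Nat.div_le_self _ _
  have hval := cyclicProportion_eq_prod_irredFactors B hn hsep
  -- The lower bound is the value obtained with every `N_f` replaced by `1`: there are `s` factors
  -- over `K`, each contributing `1 / 2`.
  have hlow : 1 / (2 : ℝ) ^ s = ∏ f ∈ irredFactors (X ^ n - 1 : K[X]), (1 - 1 / (2 : ℝ) ^ 1) := by
    rw [prod_irredFactors_X_pow_sub_one_of_const hn hqn _ (fun _ => 1 - 1 / (2 : ℝ) ^ 1)
      fun _ _ _ _ => rfl, Finset.prod_pow_eq_pow_sum, ← hs,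
      show (1 : ℝ) - 1 / 2 ^ 1 = 1 / 2 by norm_num, one_div_pow]
  -- The upper bound is the value obtained with every `N_f` replaced by `deg f`.
  have hupp : ∏ d ∈ n.divisors, (1 - 1 / (2 : ℝ) ^ ordMod d (Nat.card K)) ^ tInv d (Nat.card K) =
      ∏ f ∈ irredFactors (X ^ n - 1 : K[X]), (1 - 1 / (2 : ℝ) ^ f.natDegree) :=
    (prod_irredFactors_X_pow_sub_one_of_const hn hqn _
      (fun d => 1 - 1 / (2 : ℝ) ^ ordMod d (Nat.card K))
      fun d hd f hf => by rw [hdeg d hd f hf]).symm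
  have hlow_iff : cyclicProportion n B = 1 / (2 : ℝ) ^ s ↔
      ∀ f ∈ irredFactors (X ^ n - 1 : K[X]), splitNumber L f = 1 := by
    rw [hval, hlow, eq_comm, prod_eq_prod_iff_of_le
      (fun _ _ => one_sub_one_div_two_pow_pos one_pos)
      (fun f hf => one_sub_one_div_two_pow_le_iff.2 (hpos f hf))]
    simp only [one_sub_one_div_two_pow_inj, eq_comm]
  have hupp_iff : cyclicProportion n B =
      ∏ d ∈ n.divisors, (1 - 1 / (2 : ℝ) ^ ordMod d (Nat.card K)) ^ tInv d (Nat.card K) ↔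
      ordMod n (Nat.card K) ∣ m := by
    rw [hval, hupp, prod_eq_prod_iff_of_le
      (fun f hf => one_sub_one_div_two_pow_pos (hpos f hf))
      (fun f hf => one_sub_one_div_two_pow_le_iff.2 (hle f hf))]
    simp only [one_sub_one_div_two_pow_inj]
    rw [← forall_nInv_eq_ordMod_iff m hn hqn]
    exact forall_mem_irredFactors_X_pow_sub_one_iff hn fun d hd f hf => by
      rw [hsplit d hd f hf, hdeg d hd f hf]
  refine ⟨?_, ?_, ?_, ?_, ?_, ?_, hupp_iff, ?_⟩
  · rw [hval]
    exact prod_irredFactors_X_pow_sub_one_of_const hn hqn _ _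
      fun d hd f hf => by rw [hsplit d hd f hf]
  · rw [hval, hlow]
    exact Finset.prod_le_prod (fun _ _ => (one_sub_one_div_two_pow_pos one_pos).le)
      fun f hf => one_sub_one_div_two_pow_le_iff.2 (hpos f hf)
  · rw [hval, hupp]
    exact Finset.prod_le_prod (fun f hf => (one_sub_one_div_two_pow_pos (hpos f hf)).le)
      fun f hf => one_sub_one_div_two_pow_le_iff.2 (hle f hf)
  · rw [hlow_iff, ← forall_nInv_eq_one_iff m hn hqn]
    exact forall_mem_irredFactors_X_pow_sub_one_iff hn fun d hd f hf => by rw [hsplit d hd f hf]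
  · rw [hlow_iff]
    have h0 := X_pow_sub_one_ne_zero (L := K) hn
    constructor
    · intro h f hfm hf hd
      exact (irreducible_map_iff_splitNumber hf hfm (hsep.of_dvd hd)).2
        (h f ((mem_irredFactors h0).2 ⟨hf, hfm, hd⟩))
    · intro h f hfm
      obtain ⟨hf, hfm, hd⟩ := (mem_irredFactors h0).1 hfm
      exact (irreducible_map_iff_splitNumber hf hfm (hsep.of_dvd hd)).1 (h f hfm hf hd)
  · rw [hlow_iff, forall_genRankWeight_one_eq_one_iff B hn hsep]
  -- Splitting over `L` means `o_n(q ^ m) = 1`, which says that `o_n(q)` divides `m`.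
  · rw [hupp_iff, map_X_pow_sub_one, splits_X_pow_sub_one_iff hn (hL ▸ Nat.Coprime.pow_left m hqn),
      hL, ordMod_pow_eq_one_iff]
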